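/- For a finite simple graph $G$ and an integer $t\ge 0$, let $i_t(G)$ denote the number of independent sets of size $t$ in $G$, and let $K_{a,b}$ be the complete bipartite graph with partite sets of sizes $a$ and $b$. Let $G$ be a graph with $n$ vertices and minimum degree exactly $\delta$. Equality of graphs below means isomorphism. 1. If $\delta=2$ and $t\ge 3$, then $i_t(G)\le i_t(K_{2,n-2})$. If moreover $n\ge 5$ and $3\le t\le n-2$, then equality holds if and only if $G=K_{2,n-2}$ or $G$ is the graph obtained from $K_{2,n-2}$ by joining the two vertices of the partite set of size $2$ by an edge. 2. If $\delta=3$ and $t\ge 3$, then $i_t(G)\le i_t(K_{3,n-3})$. If moreover $n\ge 6$ and $t=3$, then equality holds if and only if $G=K_{3,n-3}$. If $n\ge 7$ and $4\le t\le n-3$, then equality holds if and only if $G$ is obtained from $K_{3,n-3}$ by adding some (possibly no) edges inside the partite set of size $3$. 3. If $\delta\ge 3$ and $t\ge 2\delta+1$, then $i_t(G)\le i_t(K_{\delta,n-\delta})$. If moreover $n\ge 3\delta+1$ and $2\delta+1\le t\le n-\delta$, then equality holds if and only if $G$ is obtained from $K_{\delta,n-\delta}$ by adding some (possibly no) edges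 inside the partite set of size $\delta$. -/

import Mathlib

/-- `i_t(G)`: the number of independent sets of size `t` in the graph `G`. -/
noncomputable def indepCount {V : Type*} (G : SimpleGraph V) (t : ℕ) : ℕ :=
  {s : Finset V | G.IsNIndepSet t s}.ncard

/-- The complete bipartite graph `K_{a,b}`. -/
abbrev completeBip (a b : ℕ) : SimpleGraph (Fin a ⊕ Fin b) :=
  completeBipartiteGraph (Fin a) (Fin b)

/-- The graph obtained from `K_{a,b}` by adding the edges of the graph `F` inside
the partite set of size `a`. -/
def completeBipPlus {a : ℕ} (F : SimpleGraph (Fin a)) (b : ℕ) : SimpleGraph (Fin a ⊕ Fin b) :=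
  completeBip a b ⊔ F.map Function.Embedding.inl

/-!
Write `ρ_t(S) = i_t(S) / C(m, t)` with `m = n - δ`. Every vertex has fewer than `m` non-neighbours,
and `ρ_{t+1}(S)` is `1 / m` times the sum over `v ∈ S` of the density `ρ_t`, taken relative to
`m - 1`, of the set of non-neighbours of `v`. Induction through this identity shows that `ρ_t`
decreases in `t ≥ 1` and, on sets of at most `m` vertices, that `ρ_{s+t} ≤ ρ_s ρ_t`. Since `t > δ`
turns the bound `C(m, t) + C(δ, t)` into `ρ_t ≤ 1`, the bound propagates from any such `t` upwards.

A vertex `v` with so few non-neighbours that they carry at most `C(δ - 1, t - 1)` independent sets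
of size `t - 1` can be deleted, which lowers `δ` by one while `m` stays fixed. For `t = 3` this
leaves the case where every vertex has at least `δ` non-neighbours, and there Goodman's double count
of triples gives a strict inequality. For `t > 2δ` it leaves the case where the non-neighbours of
every vertex contain an independent set of size `t - 1 ≥ 2δ`, so that the density `ρ_2` of these
non-neighbours is bounded below. As `ρ_{t-1} ≤ ρ_2 ^ 2` there, replacing the square by a chord
and summing over the vertices bounds `i_t` in terms of `i_3`.

Equality forces an independent set of size `m`. Its vertices have fewer than `m` non-neighbours, so
they are joined to all of the remaining `δ` vertices.
-/

section IndepSets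

open Finset
open scoped Classical

/-- The non-neighbours of `v` inside `S`; the vertex `v` itself is not one of them. -/
noncomputable def nonNbrs {V : Type*} (G : SimpleGraph V) (S : Finset V) (v : V) : Finset V :=
  {w ∈ S | Gᶜ.Adj v w}

/-- The independent sets of size `t` contained in `S`. Relative to `S` rather than in an induced
subgraph, so that the inductions can delete vertices without changing the vertex type. -/
noncomputable def indepSets {V : Type*} (G : SimpleGraph V) (S : Finset V) (t : ℕ) :
    Finset (Finset V) :=
  {s ∈ S.powersetCard t | G.IsIndepSet (s : Set V)}

/-- The number of independent `t`-sets in `S` as a fraction of the number of `t`-subsets of a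
`D`-set. It is compared with `1`, the value at an independent `D`-set, so `#S` may exceed `D`; for
`t > D` the denominator vanishes and the value is `0`. -/
noncomputable def indepDensity {V : Type*} (G : SimpleGraph V) (S : Finset V) (D t : ℕ) : ℚ :=
  #(indepSets G S t) / D.choose t

variable {V : Type*} {G : SimpleGraph V} {S T s : Finset V} {v w : V} {t r m D δ : ℕ}

/-! ### Counting through non-neighbours -/

lemma mem_nonNbrs : w ∈ nonNbrs G S v ↔ w ∈ S ∧ Gᶜ.Adj v w := mem_filter

lemma mem_indepSets : s ∈ indepSets G S t ↔ s ⊆ S ∧ #s = t ∧ G.IsIndepSet (s : Set V) := by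
  simp [indepSets, and_assoc]

lemma nonNbrs_mono (h : S ⊆ T) : nonNbrs G S v ⊆ nonNbrs G T v := filter_subset_filter _ h

lemma nonNbrs_subset_erase : nonNbrs G S v ⊆ S.erase v := fun _ hw =>
  mem_erase.2 ⟨(mem_nonNbrs.1 hw).2.ne', (mem_nonNbrs.1 hw).1⟩

lemma card_nonNbrs_le_of_mem (hv : v ∈ S) (hS : #S ≤ D + 1) : #(nonNbrs G S v) ≤ D := by
  have := card_le_card (nonNbrs_subset_erase (G := G) (S := S) (v := v))
  rw [card_erase_of_mem hv] at this
  omega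

lemma card_filter_adj_add_card_nonNbrs (hv : v ∈ S) :
    #{w ∈ S | G.Adj v w} + #(nonNbrs G S v) + 1 = #S := by
  rw [← card_erase_add_one hv, ← card_union_of_disjoint]
  · congr 2
    ext w
    simp only [mem_union, mem_filter, mem_nonNbrs, mem_erase, SimpleGraph.compl_adj]
    grind [SimpleGraph.Adj.ne]
  · exact disjoint_filter.2 fun w _ hvw hvw' => (SimpleGraph.compl_adj ..).1 hvw' |>.2 hvw

lemma card_nonNbrs_erase_lt (h : ∀ w ∈ S, #(nonNbrs G S w) < m) (v : V) :
    ∀ w ∈ S.erase v, #(nonNbrs G (S.erase v) w) < m := fun w hw =>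
  (card_le_card (nonNbrs_mono (erase_subset _ _))).trans_lt (h w (mem_of_mem_erase hw))

lemma indepSets_mono (h : S ⊆ T) : indepSets G S t ⊆ indepSets G T t :=
  filter_subset_filter _ (powersetCard_mono h)

lemma card_indepSets_le_choose (hS : #S ≤ D) : #(indepSets G S t) ≤ D.choose t :=
  calc #(indepSets G S t) ≤ #(S.powersetCard t) := card_filter_le _ _
    _ = (#S).choose t := card_powersetCard _ _
    _ ≤ D.choose t := Nat.choose_le_choose t hS

lemma choose_le_card_indepSets (h : (indepSets G S t).Nonempty) (r : ℕ) :
    t.choose r ≤ #(indepSets G S r) := by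
  obtain ⟨u, hu⟩ := h
  obtain ⟨huS, rfl, hi⟩ := mem_indepSets.1 hu
  rw [← card_powersetCard]
  refine card_le_card fun s hs => ?_
  obtain ⟨hsu, hs⟩ := mem_powersetCard.1 hs
  exact mem_indepSets.2 ⟨hsu.trans huS, hs, hi.mono (coe_subset.2 hsu)⟩

lemma card_indepSets_zero : #(indepSets G S 0) = 1 := by
  simp [indepSets, filter_singleton, SimpleGraph.IsIndepSet]

lemma isIndepSet_insert (hv : v ∉ s) :
    G.IsIndepSet ((insert v s : Finset V) : Set V) ↔
      G.IsIndepSet (s : Set V) ∧ ∀ w ∈ s, Gᶜ.Adj v w := by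
  rw [← SimpleGraph.isClique_compl, ← SimpleGraph.isClique_compl, coe_insert,
    SimpleGraph.isClique_insert_of_notMem (mod_cast hv)]
  simp only [mem_coe]

lemma card_filter_mem_indepSets_succ (hv : v ∈ S) :
    #{s ∈ indepSets G S (t + 1) | v ∈ s} = #(indepSets G (nonNbrs G S v) t) := by
  have notMem_of_subset {s : Finset V} (hs : s ⊆ nonNbrs G S v) : v ∉ s := fun h =>
    (mem_erase.1 (nonNbrs_subset_erase (hs h))).1 rfl
  symm
  refine card_bij' (fun s _ => insert v s) (fun s _ => s.erase v) (fun s hs => ?_)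
    (fun s hs => ?_) (fun s hs => erase_insert (notMem_of_subset (mem_indepSets.1 hs).1))
    (fun s hs => insert_erase (mem_filter.1 hs).2)
  · obtain ⟨hsN, hc, hi⟩ := mem_indepSets.1 hs
    have hvs := notMem_of_subset hsN
    refine mem_filter.2 ⟨mem_indepSets.2 ⟨insert_subset hv (hsN.trans (filter_subset _ _)), ?_, ?_⟩,
      mem_insert_self v s⟩
    · rw [card_insert_of_notMem hvs, hc]
    · exact (isIndepSet_insert hvs).2 ⟨hi, fun w hw => (mem_nonNbrs.1 (hsN hw)).2⟩
  · obtain ⟨hs, hvs⟩ := mem_filter.1 hs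
    obtain ⟨hsS, hc, hi⟩ := mem_indepSets.1 hs
    rw [← insert_erase hvs, isIndepSet_insert (notMem_erase v s)] at hi
    refine mem_indepSets.2 ⟨fun w hw => ?_, by rw [card_erase_of_mem hvs, hc]; rfl, hi.1⟩
    exact mem_nonNbrs.2 ⟨hsS (mem_of_mem_erase hw), hi.2 w hw⟩

lemma card_indepSets_succ (hv : v ∈ S) :
    #(indepSets G S (t + 1)) =
      #(indepSets G (S.erase v) (t + 1)) + #(indepSets G (nonNbrs G S v) t) := by
  rw [← card_filter_mem_indepSets_succ hv, ← card_filter_add_card_filter_not (fun s => v ∈ s),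
    add_comm]
  congr 2
  ext s
  simp only [mem_filter, mem_indepSets, subset_erase]
  tauto

lemma sum_card_indepSets_nonNbrs :
    ∑ v ∈ S, #(indepSets G (nonNbrs G S v) t) = (t + 1) * #(indepSets G S (t + 1)) := by
  calc ∑ v ∈ S, #(indepSets G (nonNbrs G S v) t)
      = ∑ v ∈ S, #{s ∈ indepSets G S (t + 1) | v ∈ s} :=
        sum_congr rfl fun v hv => (card_filter_mem_indepSets_succ hv).symm
    _ = ∑ s ∈ indepSets G S (t + 1), #{v ∈ S | v ∈ s} :=
        sum_card_bipartiteAbove_eq_sum_card_bipartiteBelow _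
    _ = ∑ s ∈ indepSets G S (t + 1), (t + 1) := sum_congr rfl fun s hs => by
        obtain ⟨hsS, hc, -⟩ := mem_indepSets.1 hs
        rw [filter_mem_eq_inter, inter_eq_right.2 hsS, hc]
    _ = (t + 1) * #(indepSets G S (t + 1)) := by rw [sum_const, smul_eq_mul, mul_comm]

lemma card_indepSets_eq_zero_of_lt (ht : 2 ≤ t) (hmt : m < t)
    (h : ∀ v ∈ S, #(nonNbrs G S v) < m) : #(indepSets G S t) = 0 := by
  obtain ⟨t, rfl⟩ := Nat.exists_eq_add_of_le' (show 1 ≤ t by omega)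
  have hlink : ∀ v ∈ S, #(indepSets G (nonNbrs G S v) t) = 0 := fun v hv =>
    Nat.eq_zero_of_le_zero <| (card_indepSets_le_choose le_rfl).trans_eq <|
      Nat.choose_eq_zero_of_lt (by have := h v hv; omega)
  simpa [sum_eq_zero hlink] using (sum_card_indepSets_nonNbrs (G := G) (S := S) (t := t)).symm

lemma sum_indepDensity_nonNbrs :
    ∑ v ∈ S, indepDensity G (nonNbrs G S v) D t = (D + 1) * indepDensity G S (D + 1) (t + 1) := by
  have hsum : ∑ v ∈ S, (#(indepSets G (nonNbrs G S v) t) : ℚ) =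
      (t + 1) * #(indepSets G S (t + 1)) := mod_cast sum_card_indepSets_nonNbrs
  simp only [indepDensity, ← sum_div, hsum]
  rcases lt_or_ge D t with hDt | htD
  · simp [Nat.choose_eq_zero_of_lt hDt, Nat.choose_eq_zero_of_lt (Nat.succ_lt_succ hDt)]
  · have hchoose : ((D + 1) * D.choose t : ℚ) = (D + 1).choose (t + 1) * (t + 1) :=
      mod_cast Nat.add_one_mul_choose_eq D t
    have hD : (D.choose t : ℚ) ≠ 0 := mod_cast (Nat.choose_pos htD).ne'
    have hD' : ((D + 1).choose (t + 1) : ℚ) ≠ 0 :=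
      mod_cast (Nat.choose_pos (Nat.succ_le_succ htD)).ne'
    field_simp
    linear_combination -(#(indepSets G S (t + 1)) : ℚ) * hchoose

lemma indepDensity_nonneg : 0 ≤ indepDensity G S D t := by
  unfold indepDensity
  positivity

lemma indepDensity_zero : indepDensity G S D 0 = 1 := by simp [indepDensity, card_indepSets_zero]

lemma indepDensity_le_one (hS : #S ≤ D) : indepDensity G S D t ≤ 1 :=
  div_le_one_of_le₀ (mod_cast card_indepSets_le_choose hS) (by positivity)

lemma indepDensity_zero_right_succ : indepDensity G S 0 (t + 1) = 0 := by simp [indepDensity]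

lemma indepDensity_le_of_sum_nonNbrs_le {c : ℚ}
    (h : ∑ v ∈ S, indepDensity G (nonNbrs G S v) D t ≤ (D + 1) * c) :
    indepDensity G S (D + 1) (t + 1) ≤ c :=
  le_of_mul_le_mul_left (sum_indepDensity_nonNbrs.symm.trans_le h) (by positivity)

lemma indepDensity_succ_le (hS : #S ≤ D) : indepDensity G S D (t + 1) ≤ indepDensity G S D t := by
  induction t generalizing S D with
  | zero => exact (indepDensity_le_one hS).trans_eq indepDensity_zero.symm
  | succ t ih =>
    rcases D with _ | D
    · simp [indepDensity_zero_right_succ]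
    · refine indepDensity_le_of_sum_nonNbrs_le ?_
      rw [← sum_indepDensity_nonNbrs]
      exact sum_le_sum fun v hv => ih (card_nonNbrs_le_of_mem hv hS)

lemma indepDensity_succ_le_of_nonNbrs (h : ∀ v ∈ S, #(nonNbrs G S v) < m) (ht : 1 ≤ t) :
    indepDensity G S m (t + 1) ≤ indepDensity G S m t := by
  obtain ⟨t, rfl⟩ := Nat.exists_eq_add_of_le' ht
  rcases m with _ | m
  · simp [indepDensity_zero_right_succ]
  · refine indepDensity_le_of_sum_nonNbrs_le ?_
    rw [← sum_indepDensity_nonNbrs]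
    exact sum_le_sum fun v hv => indepDensity_succ_le (Nat.le_of_lt_succ (h v hv))

lemma indepDensity_antitone (hS : #S ≤ D) : Antitone (indepDensity G S D) :=
  antitone_nat_of_succ_le fun _ => indepDensity_succ_le hS

lemma indepDensity_antitoneOn (h : ∀ v ∈ S, #(nonNbrs G S v) < m) :
    AntitoneOn (indepDensity G S m) (Set.Ici 1) :=
  antitoneOn_nat_Ici_of_succ_le fun _ ht => indepDensity_succ_le_of_nonNbrs h ht

lemma indepDensity_nonNbrs_le (hv : v ∈ S) (hS : #S ≤ D + 1) :
    indepDensity G (nonNbrs G S v) D t ≤ indepDensity G S (D + 1) t := by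
  rcases t with _ | t
  · simp only [indepDensity_zero, le_rfl]
  rcases lt_or_ge D (t + 1) with hDt | htD
  · simpa [indepDensity, Nat.choose_eq_zero_of_lt hDt] using indepDensity_nonneg
  have hdeletion : (#(indepSets G (nonNbrs G S v) (t + 1)) : ℚ) + #(indepSets G (nonNbrs G S v) t) ≤
      #(indepSets G S (t + 1)) := by
    rw [card_indepSets_succ hv]
    push_cast
    gcongr
    exact indepSets_mono nonNbrs_subset_erase
  have hle := indepDensity_succ_le (G := G) (t := t) (card_nonNbrs_le_of_mem (G := G) hv hS)
  have hpos : (0 : ℚ) < D.choose t := mod_cast Nat.choose_pos (by omega)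
  have hpos' : (0 : ℚ) < D.choose (t + 1) := mod_cast Nat.choose_pos htD
  have hpascal : ((D + 1).choose (t + 1) : ℚ) = D.choose t + D.choose (t + 1) :=
    mod_cast Nat.choose_succ_succ' D t
  unfold indepDensity at hle ⊢
  rw [div_le_div_iff₀ hpos' hpos] at hle
  rw [hpascal, div_le_div_iff₀ hpos' (by positivity)]
  nlinarith

lemma indepDensity_add_le_mul (hS : #S ≤ D) :
    indepDensity G S D (t + r) ≤ indepDensity G S D t * indepDensity G S D r := by
  induction t generalizing S D with
  | zero => simp [indepDensity_zero]
  | succ t ih =>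
    rw [Nat.succ_add]
    rcases D with _ | D
    · simp [indepDensity_zero_right_succ]
    · refine indepDensity_le_of_sum_nonNbrs_le ?_
      calc ∑ v ∈ S, indepDensity G (nonNbrs G S v) D (t + r)
          ≤ ∑ v ∈ S, indepDensity G (nonNbrs G S v) D t * indepDensity G S (D + 1) r :=
            sum_le_sum fun v hv => (ih (card_nonNbrs_le_of_mem hv hS)).trans <|
              mul_le_mul_of_nonneg_left (indepDensity_nonNbrs_le hv hS) indepDensity_nonneg
        _ = (D + 1) * (indepDensity G S (D + 1) (t + 1) * indepDensity G S (D + 1) r) := by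
            rw [← sum_mul, sum_indepDensity_nonNbrs, mul_assoc]

/-! ### Goodman's bound -/

/-- The vertices of `T` with both a neighbour and a non-neighbour in `T`. A triple has no such
vertex when it is a triangle or an independent set, and exactly two otherwise; counting these
vertices in two ways is the idea behind Goodman's bound. -/
noncomputable def mixedVertices {V : Type*} (G : SimpleGraph V) (T : Finset V) : Finset V :=
  {v ∈ T | (∃ x ∈ T, G.Adj v x) ∧ ∃ y ∈ T, Gᶜ.Adj v y}

lemma card_mixedVertices_le_two (hT : #T = 3) : #(mixedVertices G T) ≤ 2 := by
  suffices hne : mixedVertices G T ≠ T by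
    exact Nat.le_of_lt_succ ((card_lt_card ((filter_subset _ T).ssubset_of_ne hne)).trans_eq hT)
  intro hall
  obtain ⟨a, b, c, hab, hac, hbc, rfl⟩ := card_eq_three.1 hT
  simp only [mixedVertices, filter_eq_self, mem_insert, mem_singleton, forall_eq_or_imp, forall_eq,
    exists_eq_or_imp, exists_eq_left, SimpleGraph.compl_adj, G.adj_comm b a, G.adj_comm c a,
    G.adj_comm c b, SimpleGraph.irrefl, ne_eq, hab, hac, hbc, not_true_eq_false] at hall
  tauto

lemma mixedVertices_eq_empty (hT : G.IsIndepSet (T : Set V)) : mixedVertices G T = ∅ :=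
  filter_eq_empty_iff.2 fun _ hv ⟨⟨_, hx, hadj⟩, _⟩ => hT hv hx hadj.ne hadj

lemma card_filter_adj_mul_card_nonNbrs_le (hv : v ∈ S) :
    #{w ∈ S | G.Adj v w} * #(nonNbrs G S v) ≤
      #{T ∈ S.powersetCard 3 | v ∈ mixedVertices G T} := by
  rw [← card_product]
  refine card_le_card_of_injOn (fun p => {v, p.1, p.2}) ?_ ?_
  · rintro ⟨x, y⟩ hxy
    simp only [coe_product, Set.mem_prod, mem_coe, mem_filter, mem_nonNbrs] at hxy
    obtain ⟨⟨hx, hvx⟩, hy, hvy⟩ := hxy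
    have hxy : x ≠ y := fun h => ((SimpleGraph.compl_adj ..).1 hvy).2 (h ▸ hvx)
    refine mem_coe.2 <| mem_filter.2 ⟨mem_powersetCard.2 ⟨?_, ?_⟩, mem_filter.2 ⟨?_, ?_, ?_⟩⟩
    · simp [insert_subset_iff, hv, hx, hy]
    · exact card_eq_three.2 ⟨v, x, y, hvx.ne, hvy.ne, hxy, rfl⟩
    · simp
    · exact ⟨x, by simp, hvx⟩
    · exact ⟨y, by simp, hvy⟩
  · rintro ⟨x, y⟩ hxy ⟨x', y'⟩ hxy' heq
    simp only [coe_product, Set.mem_prod, mem_coe, mem_filter, mem_nonNbrs,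
      SimpleGraph.compl_adj] at hxy hxy'
    simp only [Finset.ext_iff, mem_insert, mem_singleton] at heq
    have hx := heq x
    have hy := heq y
    grind [SimpleGraph.Adj.ne]

lemma sum_card_filter_adj_mul_card_nonNbrs_le :
    ∑ v ∈ S, #{w ∈ S | G.Adj v w} * #(nonNbrs G S v) + 2 * #(indepSets G S 3) ≤
      2 * (#S).choose 3 := by
  calc ∑ v ∈ S, #{w ∈ S | G.Adj v w} * #(nonNbrs G S v) + 2 * #(indepSets G S 3)
      ≤ ∑ v ∈ S, #{T ∈ S.powersetCard 3 | v ∈ mixedVertices G T} + 2 * #(indepSets G S 3) := by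
        gcongr with v hv
        exact card_filter_adj_mul_card_nonNbrs_le hv
    _ = ∑ T ∈ S.powersetCard 3, #{v ∈ S | v ∈ mixedVertices G T} +
          ∑ T ∈ S.powersetCard 3, if G.IsIndepSet (T : Set V) then 2 else 0 := by
        congr 1
        · exact sum_card_bipartiteAbove_eq_sum_card_bipartiteBelow _
        · rw [← sum_filter, sum_const, smul_eq_mul, mul_comm]
          rfl
    _ = ∑ T ∈ S.powersetCard 3,
          (#{v ∈ S | v ∈ mixedVertices G T} + if G.IsIndepSet (T : Set V) then 2 else 0) :=
        sum_add_distrib.symm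
    _ ≤ ∑ _T ∈ S.powersetCard 3, 2 := by
        refine sum_le_sum fun T hT => ?_
        split_ifs with hi
        · simp [mixedVertices_eq_empty hi]
        · refine (card_le_card fun v hv => (mem_filter.1 hv).2).trans ?_
          exact card_mixedVertices_le_two (mem_powersetCard.1 hT).2
    _ = 2 * (#S).choose 3 := by rw [sum_const, card_powersetCard, smul_eq_mul, mul_comm]

lemma cast_choose_three (n : ℕ) : (n.choose 3 : ℚ) = n * (n - 1) * (n - 2) / 6 := by
  induction n with
  | zero => simp
  | succ n ih =>
    rw [Nat.choose_succ_succ' n 2, Nat.cast_add, ih, Nat.cast_choose_two]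
    push_cast
    ring

lemma two_mul_card_indepSets_three_add_le (hS : #S = m + δ)
    (h : ∀ v ∈ S, #(nonNbrs G S v) < m) (h' : ∀ v ∈ S, δ ≤ #(nonNbrs G S v)) :
    2 * (#(indepSets G S 3) : ℚ) + δ * (m - δ) ≤ 2 * (m.choose 3 + δ.choose 3) := by
  have hprod : ∀ v ∈ S, (δ : ℚ) * (m - 1) ≤ #{w ∈ S | G.Adj v w} * #(nonNbrs G S v) := by
    intro v hv
    have hsum : (#{w ∈ S | G.Adj v w} + #(nonNbrs G S v) + 1 : ℚ) = m + δ :=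
      mod_cast hS ▸ card_filter_adj_add_card_nonNbrs hv
    have hlt : (#(nonNbrs G S v) + 1 : ℚ) ≤ m := mod_cast h v hv
    have hle : (δ : ℚ) ≤ #(nonNbrs G S v) := mod_cast h' v hv
    nlinarith
  have hsum := sum_le_sum hprod
  have hgoodman : ∑ v ∈ S, (#{w ∈ S | G.Adj v w} : ℚ) * #(nonNbrs G S v) +
      2 * #(indepSets G S 3) ≤ 2 * (#S).choose 3 :=
    mod_cast sum_card_filter_adj_mul_card_nonNbrs_le
  rw [sum_const, nsmul_eq_mul, hS] at hsum
  rw [hS, cast_choose_three] at hgoodman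
  rw [cast_choose_three, cast_choose_three]
  push_cast at hsum hgoodman
  linarith

/-! ### Bounds by complete bipartite counts -/

/-- The count of independent `t`-sets in `S` is at most that of `K_{δ,m}`, with equality only if
`S` contains an independent set of size `m`. Since no vertex of `S` will have `m` non-neighbours
in `S`, such an independent set is one side of a complete bipartite graph. -/
def CompleteBipBound {V : Type*} (G : SimpleGraph V) (S : Finset V) (m δ t : ℕ) : Prop :=
  #(indepSets G S t) ≤ m.choose t + δ.choose t ∧
    (#(indepSets G S t) = m.choose t + δ.choose t → (indepSets G S m).Nonempty)

lemma CompleteBipBound.of_lt (h : #(indepSets G S t) < m.choose t + δ.choose t) :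
    CompleteBipBound G S m δ t :=
  ⟨h.le, fun h' => absurd h' h.ne⟩

lemma CompleteBipBound.of_erase (hv : v ∈ S)
    (hc : #(indepSets G (nonNbrs G S v) t) ≤ δ.choose t)
    (h : CompleteBipBound G (S.erase v) m δ (t + 1)) :
    CompleteBipBound G S m (δ + 1) (t + 1) := by
  have hdeletion := card_indepSets_succ (G := G) (t := t) hv
  have hpascal := Nat.choose_succ_succ' δ t
  refine ⟨by have := h.1; omega, fun he => ?_⟩
  exact (h.2 (by have := h.1; omega)).mono (indepSets_mono (erase_subset _ _))

lemma completeBipBound_iff_indepDensity (hδ : δ < t) (htm : t ≤ m) :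
    CompleteBipBound G S m δ t ↔
      indepDensity G S m t ≤ 1 ∧ (indepDensity G S m t = 1 → (indepSets G S m).Nonempty) := by
  have hpos : (0 : ℚ) < m.choose t := mod_cast Nat.choose_pos htm
  rw [CompleteBipBound, Nat.choose_eq_zero_of_lt hδ, add_zero, indepDensity, div_le_one hpos,
    div_eq_one_iff_eq hpos.ne', Nat.cast_le, Nat.cast_inj]

lemma CompleteBipBound.of_le (h : ∀ v ∈ S, #(nonNbrs G S v) < m) (hδ : δ < r) (hrt : r ≤ t)
    (htm : t ≤ m) (hb : CompleteBipBound G S m δ r) : CompleteBipBound G S m δ t := by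
  rw [completeBipBound_iff_indepDensity hδ (hrt.trans htm)] at hb
  rw [completeBipBound_iff_indepDensity (hδ.trans_le hrt) htm]
  have hanti := indepDensity_antitoneOn h (Set.mem_Ici.2 (show 1 ≤ r by omega))
    (Set.mem_Ici.2 (show 1 ≤ t by omega)) hrt
  exact ⟨hanti.trans hb.1, fun he => hb.2 (hb.1.antisymm (he ▸ hanti))⟩

lemma completeBipBound_zero (hS : #S = m) (ht : 2 ≤ t) (htm : t ≤ m) :
    CompleteBipBound G S m 0 t := by
  rw [CompleteBipBound, Nat.choose_eq_zero_of_lt (show 0 < t by omega), add_zero]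
  refine ⟨card_indepSets_le_choose hS.le, fun he => ?_⟩
  rw [← hS, ← card_powersetCard, indepSets, card_filter_eq_iff] at he
  refine ⟨S, mem_indepSets.2 ⟨subset_rfl, hS, fun x hx y hy hxy => ?_⟩⟩
  obtain ⟨u, hxyu, huS, hu⟩ := exists_subsuperset_card_eq
    (insert_subset hx (singleton_subset_iff.2 hy)) (card_le_two.trans ht) (htm.trans_eq hS.symm)
  exact he u (mem_powersetCard.2 ⟨huS, hu⟩) (hxyu (by simp)) (hxyu (by simp)) hxy

theorem completeBipBound_three (hS : #S = m + δ) (hδ : δ ≤ m) (hm : 3 ≤ m)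
    (h : ∀ v ∈ S, #(nonNbrs G S v) < m) : CompleteBipBound G S m δ 3 := by
  induction δ generalizing S with
  | zero => exact completeBipBound_zero hS (by omega) hm
  | succ δ ih =>
    by_cases hlarge : ∀ v ∈ S, δ + 1 ≤ #(nonNbrs G S v)
    · apply CompleteBipBound.of_lt
      have hgoodman := two_mul_card_indepSets_three_add_le hS h hlarge
      obtain ⟨v, hv⟩ : S.Nonempty := card_pos.1 (by omega)
      have hδm : ((δ + 1 : ℕ) : ℚ) < m := mod_cast (hlarge v hv).trans_lt (h v hv)
      have : (0 : ℚ) < (δ + 1 : ℕ) * (m - (δ + 1 : ℕ)) := mul_pos (by positivity) (by linarith)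
      qify
      linarith
    · push Not at hlarge
      obtain ⟨v, hv, hlt⟩ := hlarge
      exact .of_erase hv (card_indepSets_le_choose (Nat.le_of_lt_succ hlt)) <|
        ih (by rw [card_erase_of_mem hv, hS]; omega) (by omega) (card_nonNbrs_erase_lt h v)

theorem completeBipBound_of_le_two (hS : #S = m + δ) (hδ : δ ≤ 2) (ht : 3 ≤ t) (htm : t ≤ m)
    (h : ∀ v ∈ S, #(nonNbrs G S v) < m) : CompleteBipBound G S m δ t :=
  (completeBipBound_three hS (by omega) (by omega) h).of_le h (by omega) ht htm

theorem completeBipBound_of_eq_three (hS : #S = m + 3) (ht : 4 ≤ t) (htm : t ≤ m)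
    (h : ∀ v ∈ S, #(nonNbrs G S v) < m) : CompleteBipBound G S m 3 t := by
  refine CompleteBipBound.of_le (r := 4) h (by omega) ht htm ?_
  by_cases hlarge : ∀ v ∈ S, 3 ≤ #(nonNbrs G S v)
  · have hgoodman := two_mul_card_indepSets_three_add_le hS h hlarge
    have hm : (4 : ℚ) ≤ m := mod_cast ht.trans htm
    have hlt : indepDensity G S m 3 < 1 := by
      rw [indepDensity, div_lt_one (mod_cast Nat.choose_pos (by omega))]
      rw [Nat.choose_self] at hgoodman
      push_cast at hgoodman
      linarith
    have hlt' := (indepDensity_succ_le_of_nonNbrs h (by omega)).trans_lt hlt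
    exact (completeBipBound_iff_indepDensity (by omega) (by omega)).2
      ⟨hlt'.le, fun he => absurd he hlt'.ne⟩
  · push Not at hlarge
    obtain ⟨v, hv, hlt⟩ := hlarge
    exact .of_erase hv (card_indepSets_le_choose (Nat.le_of_lt_succ hlt)) <|
      completeBipBound_of_le_two (by rw [card_erase_of_mem hv, hS]; omega) le_rfl (by omega)
        (by omega) (card_nonNbrs_erase_lt h v)

lemma indepDensity_mul_one_sub_le {γ : ℚ} (hS : #S ≤ D) (ht : 4 ≤ t) (hγ₀ : 0 ≤ γ)
    (hγ : 2 * γ ≤ indepDensity G S D 2) :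
    indepDensity G S D t * (1 - γ) ≤ indepDensity G S D 2 - γ := by
  obtain ⟨t, rfl⟩ := Nat.exists_eq_add_of_le' (show 2 ≤ t by omega)
  have hone : indepDensity G S D 2 ≤ 1 := indepDensity_le_one hS
  have hsq : indepDensity G S D (t + 2) ≤ indepDensity G S D 2 ^ 2 := by
    calc indepDensity G S D (t + 2) ≤ indepDensity G S D t * indepDensity G S D 2 :=
          indepDensity_add_le_mul hS
      _ ≤ indepDensity G S D 2 * indepDensity G S D 2 :=
          mul_le_mul_of_nonneg_right (indepDensity_antitone hS (by omega)) indepDensity_nonneg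
      _ = indepDensity G S D 2 ^ 2 := (sq _).symm
  -- The convex function `x²` lies below its chord between `γ / (1 - γ)` and `1`.
  have hchord : 0 ≤ (1 - indepDensity G S D 2) *
      (indepDensity G S D 2 - γ * (1 + indepDensity G S D 2)) :=
    mul_nonneg (by linarith) (by nlinarith)
  nlinarith

lemma indepDensity_succ_mul_one_sub_le {γ : ℚ} (h : ∀ v ∈ S, #(nonNbrs G S v) ≤ D) (ht : 4 ≤ t)
    (hγ₀ : 0 ≤ γ) (hγ : ∀ v ∈ S, 2 * γ ≤ indepDensity G (nonNbrs G S v) D 2) :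
    (D + 1) * indepDensity G S (D + 1) (t + 1) * (1 - γ) ≤
      (D + 1) * indepDensity G S (D + 1) 3 - #S * γ := by
  rw [← sum_indepDensity_nonNbrs, ← sum_indepDensity_nonNbrs, sum_mul, ← nsmul_eq_mul,
    ← sum_const, ← sum_sub_distrib]
  exact sum_le_sum fun v hv => indepDensity_mul_one_sub_le (h v hv) ht hγ₀ (hγ v hv)

lemma two_mul_choose_two_le (hδ : 2 * (δ + 1) ≤ t) : 2 * δ.choose 2 ≤ t.choose 2 := by
  have hδ' : 2 * ((δ : ℚ) + 1) ≤ t := mod_cast hδ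
  qify
  rw [Nat.cast_choose_two, Nat.cast_choose_two]
  nlinarith

lemma two_mul_div_le_indepDensity_two (hδ : 2 * (δ + 1) ≤ t) (hD : 2 ≤ D)
    (hne : (indepSets G S t).Nonempty) :
    2 * (δ.choose 2 / D.choose 2 : ℚ) ≤ indepDensity G S D 2 := by
  have hpos : (0 : ℚ) < D.choose 2 := mod_cast Nat.choose_pos hD
  rw [indepDensity, ← mul_div_assoc, div_le_div_iff_of_pos_right hpos]
  exact_mod_cast (two_mul_choose_two_le hδ).trans (choose_le_card_indepSets hne 2)

-- The excess `δ + 1` of `#S` over `D + 1` costs `(δ + 1) * γ` in the summed chord inequality, and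
-- `γ` is chosen so that this is exactly the contribution of `(δ + 1).choose 3` to the bound.
lemma add_one_mul_choose_three_eq (hD : 2 ≤ D) :
    (D + 1) * ((δ + 1).choose 3 : ℚ) =
      (δ + 1) * (δ.choose 2 / D.choose 2) * (D + 1).choose 3 := by
  have hpos : (0 : ℚ) < D.choose 2 := mod_cast Nat.choose_pos hD
  have hDchoose : ((D + 1) * D.choose 2 : ℚ) = (D + 1).choose 3 * 3 :=
    mod_cast Nat.add_one_mul_choose_eq D 2
  have hδchoose : ((δ + 1) * δ.choose 2 : ℚ) = (δ + 1).choose 3 * 3 :=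
    mod_cast Nat.add_one_mul_choose_eq δ 2
  field_simp
  linear_combination (-(D + 1) * D.choose 2 * hδchoose + (δ + 1) * δ.choose 2 * hDchoose) / 3

lemma choose_three_add_choose_three_sub_le (hS : #S = D + 1 + (δ + 1)) (hδ : 2 * (δ + 1) ≤ t)
    (ht : 4 ≤ t) (hD : 2 ≤ D) (h : ∀ v ∈ S, #(nonNbrs G S v) ≤ D)
    (hne : ∀ v ∈ S, (indepSets G (nonNbrs G S v) t).Nonempty) :
    ((D + 1).choose 3 + (δ + 1).choose 3 - #(indepSets G S 3) : ℚ) ≤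
      (D + 1).choose 3 * (1 - δ.choose 2 / D.choose 2) *
        (1 - indepDensity G S (D + 1) (t + 1)) := by
  have hsum := indepDensity_succ_mul_one_sub_le h ht (by positivity) fun v hv =>
    two_mul_div_le_indepDensity_two hδ hD (hne v hv)
  have hthree : indepDensity G S (D + 1) 3 * (D + 1).choose 3 = #(indepSets G S 3) :=
    div_mul_cancel₀ _ (mod_cast (Nat.choose_pos (by omega)).ne')
  rw [hS] at hsum
  push_cast at hsum
  refine le_of_mul_le_mul_left ?_ (show (0 : ℚ) < D + 1 by positivity)
  linear_combination
    ((D + 1).choose 3 : ℚ) * hsum + add_one_mul_choose_three_eq (δ := δ) hD + (D + 1) * hthree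

theorem CompleteBipBound.succ_of_three (hS : #S = D + 1 + (δ + 1)) (hδ : 2 * (δ + 1) ≤ t)
    (ht : 4 ≤ t) (htD : t ≤ D) (h : ∀ v ∈ S, #(nonNbrs G S v) ≤ D)
    (hne : ∀ v ∈ S, (indepSets G (nonNbrs G S v) t).Nonempty)
    (hb : CompleteBipBound G S (D + 1) (δ + 1) 3) :
    CompleteBipBound G S (D + 1) (δ + 1) (t + 1) := by
  have hslack := choose_three_add_choose_three_sub_le hS hδ ht (by omega) h hne
  have hpos : (0 : ℚ) < (D + 1).choose 3 * (1 - δ.choose 2 / D.choose 2) := by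
    obtain ⟨v, hv⟩ : S.Nonempty := card_pos.1 (by omega)
    have hle := (two_mul_div_le_indepDensity_two hδ (by omega) (hne v hv)).trans
      (indepDensity_le_one (h v hv))
    exact mul_pos (mod_cast Nat.choose_pos (by omega)) (by linarith)
  rw [completeBipBound_iff_indepDensity (by omega) (by omega)]
  constructor
  · have hb₁ : (#(indepSets G S 3) : ℚ) ≤ (D + 1).choose 3 + (δ + 1).choose 3 := mod_cast hb.1
    exact sub_nonneg.1 (nonneg_of_mul_nonneg_right ((sub_nonneg.2 hb₁).trans hslack) hpos)
  · intro heq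
    rw [heq, sub_self, mul_zero, sub_nonpos] at hslack
    exact hb.2 (hb.1.antisymm (mod_cast hslack))

theorem completeBipBound_of_two_mul_lt (hS : #S = m + δ) (hδ : 2 * δ < t) (ht : 2 ≤ t)
    (htm : t ≤ m) (h : ∀ v ∈ S, #(nonNbrs G S v) < m) : CompleteBipBound G S m δ t := by
  induction δ generalizing S with
  | zero => exact completeBipBound_zero hS ht htm
  | succ δ ih =>
    rcases le_or_gt (δ + 1) 2 with hδ₂ | hδ₂
    · exact completeBipBound_of_le_two hS hδ₂ (by omega) htm h
    obtain ⟨t, rfl⟩ := Nat.exists_eq_add_of_le' (show 1 ≤ t by omega)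
    obtain ⟨D, rfl⟩ := Nat.exists_eq_add_of_le' (show 1 ≤ m by omega)
    by_cases hne : ∀ v ∈ S, (indepSets G (nonNbrs G S v) t).Nonempty
    · exact (completeBipBound_three hS (by omega) (by omega) h).succ_of_three hS (by omega)
        (by omega) (by omega) (fun v hv => Nat.le_of_lt_succ (h v hv)) hne
    · push Not at hne
      obtain ⟨v, hv, hempty⟩ := hne
      exact .of_erase hv (by simp [hempty]) <|
        ih (by rw [card_erase_of_mem hv, hS]; omega) (by omega) (card_nonNbrs_erase_lt h v)

/-! ### Complete bipartite graphs -/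

lemma indepCount_eq_card_indepSets [Fintype V] : indepCount G t = #(indepSets G univ t) := by
  rw [indepCount, ← Set.ncard_coe_finset]
  congr 1
  ext s
  simp [mem_indepSets, SimpleGraph.isNIndepSet_iff, and_comm]

lemma isNIndepSet_map_iff {W : Type*} {H : SimpleGraph W} (f : G ↪g H) :
    H.IsNIndepSet t (s.map f.toEmbedding) ↔ G.IsNIndepSet t s := by
  rw [SimpleGraph.isNIndepSet_iff, SimpleGraph.isNIndepSet_iff, card_map, coe_map,
    SimpleGraph.isIndepSet_iff, f.toEmbedding.injective.injOn.pairwise_image]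
  simp only [Set.Pairwise, Function.onFun, RelEmbedding.coe_toEmbedding,
    SimpleGraph.Embedding.map_adj_iff, SimpleGraph.isIndepSet_iff]

lemma indepCount_congr {W : Type*} {H : SimpleGraph W} (e : G ≃g H) (t : ℕ) :
    indepCount G t = indepCount H t :=
  Set.ncard_congr' <| e.toEquiv.finsetCongr.subtypeEquiv fun _ =>
    (isNIndepSet_map_iff e.toEmbedding).symm

section CompleteBip

variable {a b : ℕ} {F : SimpleGraph (Fin a)}

lemma completeBipPlus_adj_inl_inl {x y : Fin a} :
    (completeBipPlus F b).Adj (Sum.inl x) (Sum.inl y) ↔ F.Adj x y := by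
  simp [completeBipPlus]

lemma completeBipPlus_adj_inl_inr {x : Fin a} {y : Fin b} :
    (completeBipPlus F b).Adj (Sum.inl x) (Sum.inr y) := by
  simp [completeBipPlus]

lemma not_completeBipPlus_adj_inr_inr {x y : Fin b} :
    ¬ (completeBipPlus F b).Adj (Sum.inr x) (Sum.inr y) := by
  simp [completeBipPlus]

lemma completeBipPlus_bot : completeBipPlus (⊥ : SimpleGraph (Fin a)) b = completeBip a b :=
  sup_eq_left.2 fun x y hxy => by simp [SimpleGraph.map_adj] at hxy

lemma isIndepSet_disjSum {L : Finset (Fin a)} {R : Finset (Fin b)} :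
    (completeBipPlus F b).IsIndepSet (L.disjSum R : Set (Fin a ⊕ Fin b)) ↔
      F.IsIndepSet (L : Set (Fin a)) ∧ (L = ∅ ∨ R = ∅) := by
  simp only [SimpleGraph.isIndepSet_iff, Set.Pairwise, Sum.forall, mem_coe, inl_mem_disjSum,
    inr_mem_disjSum, completeBipPlus_adj_inl_inl, completeBipPlus_adj_inl_inr,
    completeBipPlus_adj_inl_inr.symm, not_completeBipPlus_adj_inr_inr, eq_empty_iff_forall_notMem]
  grind

lemma indepSets_completeBipPlus :
    indepSets (completeBipPlus F b) univ t =
      (univ.powersetCard t).image (·.map .inr) ∪ (indepSets F univ t).image (·.map .inl) := by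
  ext s
  obtain ⟨L, R, rfl⟩ : ∃ L R, s = disjSum L R := ⟨_, _, toLeft_disjSum_toRight.symm⟩
  simp only [mem_union, mem_image, mem_indepSets, mem_powersetCard, subset_univ, true_and,
    isIndepSet_disjSum, card_disjSum, ← empty_disjSum, ← disjSum_empty,
    disjSum_inj]
  have hempty : F.IsIndepSet ((∅ : Finset (Fin a)) : Set (Fin a)) := by simp
  grind

lemma indepCount_completeBipPlus (ht : 1 ≤ t) :
    indepCount (completeBipPlus F b) t = b.choose t + indepCount F t := by
  have hdisj : Disjoint
      ((univ.powersetCard t).image (Finset.map (.inr : Fin b ↪ Fin a ⊕ Fin b)))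
      ((indepSets F univ t).image (Finset.map .inl)) := by
    simp only [disjoint_left, mem_image, mem_powersetCard, not_exists, not_and]
    rintro _ ⟨R, ⟨-, hR⟩, rfl⟩ L - hLR
    obtain ⟨y, hy⟩ : R.Nonempty := card_pos.1 (by omega)
    have hyL : Sum.inr y ∈ L.map .inl := hLR ▸ mem_map_of_mem .inr hy
    simp at hyL
  rw [indepCount_eq_card_indepSets, indepSets_completeBipPlus, card_union_of_disjoint hdisj,
    card_image_of_injective _ (map_injective _), card_image_of_injective _ (map_injective _),
    card_powersetCard, card_univ, Fintype.card_fin, indepCount_eq_card_indepSets]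

lemma indepCount_bot : indepCount (⊥ : SimpleGraph (Fin a)) t = a.choose t := by
  simp [indepCount_eq_card_indepSets, indepSets, SimpleGraph.isIndepSet_iff, Set.Pairwise]

lemma indepCount_completeBip (ht : 1 ≤ t) :
    indepCount (completeBip a b) t = b.choose t + a.choose t := by
  rw [← completeBipPlus_bot, indepCount_completeBipPlus ht, indepCount_bot]

end CompleteBip

lemma indepCount_eq_zero_of_lt [Fintype V] (ht : Fintype.card V < t) : indepCount G t = 0 := by
  rw [indepCount_eq_card_indepSets]
  exact Nat.eq_zero_of_le_zero <|
    (card_indepSets_le_choose card_univ.le).trans_eq (Nat.choose_eq_zero_of_lt ht)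

lemma eq_bot_of_indepCount_eq_choose [Fintype V] (ht : 2 ≤ t) (htV : t ≤ Fintype.card V)
    (h : indepCount G t = (Fintype.card V).choose t) : G = ⊥ := by
  obtain ⟨s, hs⟩ := (completeBipBound_zero (G := G) card_univ ht htV).2
    (by rw [← indepCount_eq_card_indepSets, h, Nat.choose_eq_zero_of_lt (show 0 < t by omega),
      add_zero])
  obtain ⟨-, hc, hi⟩ := mem_indepSets.1 hs
  obtain rfl := card_eq_iff_eq_univ s |>.1 hc
  exact SimpleGraph.eq_bot_iff_forall_not_adj.2 fun x y hadj =>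
    hi (mem_coe.2 (mem_univ x)) (mem_coe.2 (mem_univ y)) hadj.ne hadj

lemma eq_bot_or_eq_top_of_fin_two (F : SimpleGraph (Fin 2)) : F = ⊥ ∨ F = ⊤ := by
  by_cases hF : F.Adj 0 1
  · right
    ext x y
    fin_cases x <;> fin_cases y <;> simp [hF, hF.symm]
  · left
    ext x y
    fin_cases x <;> fin_cases y <;> simp [hF, F.adj_comm 1 0]

lemma exists_iso_completeBipPlus_two_iff :
    (∃ F : SimpleGraph (Fin 2), Nonempty (G ≃g completeBipPlus F m)) ↔
      Nonempty (G ≃g completeBip 2 m) ∨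
        Nonempty (G ≃g completeBipPlus (⊤ : SimpleGraph (Fin 2)) m) := by
  rw [← completeBipPlus_bot]
  constructor
  · rintro ⟨F, e⟩
    rcases eq_bot_or_eq_top_of_fin_two F with rfl | rfl
    exacts [.inl e, .inr e]
  · rintro (e | e)
    exacts [⟨⊥, e⟩, ⟨⊤, e⟩]

lemma adj_of_card_nonNbrs_lt (hsS : s ⊆ S) (hi : G.IsIndepSet (s : Set V)) (hv : v ∈ s)
    (hw : w ∈ S) (hws : w ∉ s) (hlt : #(nonNbrs G S v) < #s) : G.Adj v w := by
  by_contra hadj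
  have hvw : v ≠ w := fun h => hws (h ▸ hv)
  have hsub : insert w (s.erase v) ⊆ nonNbrs G S v := by
    refine insert_subset (mem_nonNbrs.2 ⟨hw, (SimpleGraph.compl_adj ..).2 ⟨hvw, hadj⟩⟩) ?_
    intro x hx
    obtain ⟨hxv, hx⟩ := mem_erase.1 hx
    exact mem_nonNbrs.2 ⟨hsS hx, (SimpleGraph.compl_adj ..).2 ⟨hxv.symm, hi hv hx hxv.symm⟩⟩
  have hle := card_le_card hsub
  rw [card_insert_of_notMem fun h => hws (mem_of_mem_erase h), card_erase_add_one hv] at hle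
  omega

lemma exists_iso_completeBipPlus_of_isIndepSet [Fintype V] (hs : #s = m)
    (hsc : #sᶜ = δ) (hi : G.IsIndepSet (s : Set V)) (hadj : ∀ v ∈ s, ∀ w ∉ s, G.Adj v w) :
    ∃ F : SimpleGraph (Fin δ), Nonempty (G ≃g completeBipPlus F m) := by
  let outside : Fin δ ≃ {v // v ∉ s} :=
    (Fintype.equivFinOfCardEq (by simpa [Fintype.card_subtype_compl, card_compl] using hsc)).symm
  let inside : Fin m ≃ {v // v ∈ s} := (Fintype.equivFinOfCardEq (by simpa using hs)).symm
  let e : Fin δ ⊕ Fin m ≃ V :=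
    (outside.sumCongr inside).trans <| (Equiv.sumComm _ _).trans (Equiv.sumCompl (· ∈ s))
  refine ⟨G.comap fun i => (outside i : V), ⟨SimpleGraph.Iso.symm ⟨e, ?_⟩⟩⟩
  rintro (x | x) (y | y)
  · rw [completeBipPlus_adj_inl_inl]
    rfl
  · exact iff_of_true (hadj _ (inside y).2 _ (outside x).2).symm completeBipPlus_adj_inl_inr
  · exact iff_of_true (hadj _ (inside x).2 _ (outside y).2) completeBipPlus_adj_inl_inr.symm
  · exact iff_of_false (fun h => hi (inside x).2 (inside y).2 h.ne h)
      not_completeBipPlus_adj_inr_inr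

variable [Fintype V]

lemma exists_iso_completeBipPlus (hn : Fintype.card V = m + δ)
    (h : ∀ v, #(nonNbrs G univ v) < m) (hne : (indepSets G univ m).Nonempty) :
    ∃ F : SimpleGraph (Fin δ), Nonempty (G ≃g completeBipPlus F m) := by
  obtain ⟨s, hs⟩ := hne
  obtain ⟨-, hc, hi⟩ := mem_indepSets.1 hs
  exact exists_iso_completeBipPlus_of_isIndepSet hc (by rw [card_compl, hn, hc]; omega) hi
    fun v hv w hw => adj_of_card_nonNbrs_lt (subset_univ s) hi hv (mem_univ w) hw (hc ▸ h v)

lemma card_nonNbrs_univ_lt [DecidableRel G.Adj] (hδ : δ ≤ G.minDegree) (v : V) :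
    #(nonNbrs G univ v) < Fintype.card V - δ := by
  have hsum : G.degree v + #(nonNbrs G univ v) + 1 = Fintype.card V := by
    rw [← card_univ, ← card_filter_adj_add_card_nonNbrs (G := G) (mem_univ v),
      ← SimpleGraph.card_neighborFinset_eq_degree, SimpleGraph.neighborFinset_eq_filter]
    congr
  have hmin := G.minDegree_le_degree v
  omega

lemma indepCount_le_completeBip (ht : 2 ≤ t) (h : ∀ v, #(nonNbrs G univ v) < m)
    (hb : t ≤ m → CompleteBipBound G univ m δ t) :
    indepCount G t ≤ indepCount (completeBip δ m) t := by
  rw [indepCount_completeBip (by omega), indepCount_eq_card_indepSets]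
  rcases le_or_gt t m with htm | hmt
  · exact (hb htm).1
  · rw [card_indepSets_eq_zero_of_lt ht hmt fun v _ => h v]
    exact Nat.zero_le _

lemma indepCount_eq_completeBip_iff (hn : Fintype.card V = m + δ) (hδt : δ < t)
    (h : ∀ v, #(nonNbrs G univ v) < m) (hb : CompleteBipBound G univ m δ t) :
    indepCount G t = indepCount (completeBip δ m) t ↔
      ∃ F : SimpleGraph (Fin δ), Nonempty (G ≃g completeBipPlus F m) := by
  have ht : 1 ≤ t := by omega
  rw [indepCount_completeBip ht]
  constructor
  · intro he
    exact exists_iso_completeBipPlus hn h (hb.2 (by rw [← indepCount_eq_card_indepSets, he]))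
  · rintro ⟨F, ⟨e⟩⟩
    rw [indepCount_congr e, indepCount_completeBipPlus ht,
      indepCount_eq_zero_of_lt (by simpa using hδt), Nat.choose_eq_zero_of_lt hδt]

lemma indepCount_eq_completeBip_iff_of_le (hn : Fintype.card V = m + δ) (ht : 2 ≤ t)
    (htδ : t ≤ δ) (h : ∀ v, #(nonNbrs G univ v) < m) (hb : CompleteBipBound G univ m δ t) :
    indepCount G t = indepCount (completeBip δ m) t ↔ Nonempty (G ≃g completeBip δ m) := by
  refine ⟨fun he => ?_, fun ⟨e⟩ => indepCount_congr e t⟩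
  rw [indepCount_completeBip (by omega)] at he
  obtain ⟨F, ⟨e⟩⟩ := exists_iso_completeBipPlus hn h
    (hb.2 (by rw [← indepCount_eq_card_indepSets, he]))
  rw [indepCount_congr e, indepCount_completeBipPlus (by omega), Nat.add_left_cancel_iff] at he
  rw [eq_bot_of_indepCount_eq_choose (G := F) ht (by simpa using htδ) (by simpa using he),
    completeBipPlus_bot] at e
  exact ⟨e⟩

end IndepSets

theorem mainTheorem1_general {V : Type*} [Fintype V] (G : SimpleGraph V) [DecidableRel G.Adj]
    (n δ t : ℕ) (hn : Fintype.card V = n) (hδ : δ ≤ G.minDegree) :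
    (δ = 2 → 3 ≤ t →
      indepCount G t ≤ indepCount (completeBip 2 (n - 2)) t ∧
      (t ≤ n - 2 →
        (indepCount G t = indepCount (completeBip 2 (n - 2)) t ↔
          Nonempty (G ≃g completeBip 2 (n - 2)) ∨
          Nonempty (G ≃g completeBipPlus (⊤ : SimpleGraph (Fin 2)) (n - 2))))) ∧
    (δ = 3 → 3 ≤ t →
      indepCount G t ≤ indepCount (completeBip 3 (n - 3)) t ∧
      (6 ≤ n → t = 3 →
        (indepCount G t = indepCount (completeBip 3 (n - 3)) t ↔
          Nonempty (G ≃g completeBip 3 (n - 3)))) ∧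
      (4 ≤ t → t ≤ n - 3 →
        (indepCount G t = indepCount (completeBip 3 (n - 3)) t ↔
          ∃ F : SimpleGraph (Fin 3), Nonempty (G ≃g completeBipPlus F (n - 3))))) ∧
    (2 ≤ t → 2 * δ + 1 ≤ t →
      indepCount G t ≤ indepCount (completeBip δ (n - δ)) t ∧
      (t ≤ n - δ →
        (indepCount G t = indepCount (completeBip δ (n - δ)) t ↔
          ∃ F : SimpleGraph (Fin δ), Nonempty (G ≃g completeBipPlus F (n - δ))))) := by
  have hnbr : ∀ v, (nonNbrs G Finset.univ v).card < n - δ := fun v =>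
    hn ▸ card_nonNbrs_univ_lt hδ v
  have hcard : 2 ≤ t → t ≤ n - δ → Fintype.card V = n - δ + δ := by omega
  refine ⟨?_, ?_, fun ht hδt => ?_⟩
  · rintro rfl ht
    have hbound (htm : t ≤ n - 2) : CompleteBipBound G Finset.univ (n - 2) 2 t :=
      completeBipBound_of_le_two (hcard (by omega) htm) le_rfl ht htm fun v _ => hnbr v
    refine ⟨indepCount_le_completeBip (by omega) hnbr hbound, fun htm => ?_⟩
    rw [← exists_iso_completeBipPlus_two_iff]
    exact indepCount_eq_completeBip_iff (hcard (by omega) htm) ht hnbr (hbound htm)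
  · rintro rfl ht
    have hbound (htm : t ≤ n - 3) : CompleteBipBound G Finset.univ (n - 3) 3 t := by
      rcases ht.eq_or_lt with rfl | ht
      · exact completeBipBound_three (hcard (by omega) htm) htm htm fun v _ => hnbr v
      · exact completeBipBound_of_eq_three (hcard (by omega) htm) ht htm fun v _ => hnbr v
    refine ⟨indepCount_le_completeBip (by omega) hnbr hbound, ?_, fun ht htm => ?_⟩
    · rintro hn rfl
      have htm : 3 ≤ n - 3 := by omega
      exact indepCount_eq_completeBip_iff_of_le (hcard (by omega) htm) (by omega) le_rfl hnbr
        (hbound htm)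
    · exact indepCount_eq_completeBip_iff (hcard (by omega) htm) ht hnbr (hbound htm)
  · have hbound (htm : t ≤ n - δ) : CompleteBipBound G Finset.univ (n - δ) δ t :=
      completeBipBound_of_two_mul_lt (hcard ht htm) hδt ht htm fun v _ => hnbr v
    refine ⟨indepCount_le_completeBip ht hnbr hbound, fun htm => ?_⟩
    exact indepCount_eq_completeBip_iff (hcard ht htm) (by omega) hnbr (hbound htm)

theorem mainTheorem1 {V : Type*} [Fintype V] (G : SimpleGraph V) [DecidableRel G.Adj]
    (n δ t : ℕ) (hn : Fintype.card V = n) (hδ : G.minDegree = δ) :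
    (δ = 2 → 3 ≤ t →
      indepCount G t ≤ indepCount (completeBip 2 (n - 2)) t ∧
      (5 ≤ n → t ≤ n - 2 →
        (indepCount G t = indepCount (completeBip 2 (n - 2)) t ↔
          Nonempty (G ≃g completeBip 2 (n - 2)) ∨
          Nonempty (G ≃g completeBipPlus (⊤ : SimpleGraph (Fin 2)) (n - 2))))) ∧
    (δ = 3 → 3 ≤ t →
      indepCount G t ≤ indepCount (completeBip 3 (n - 3)) t ∧
      (6 ≤ n → t = 3 →
        (indepCount G t = indepCount (completeBip 3 (n - 3)) t ↔
          Nonempty (G ≃g completeBip 3 (n - 3)))) ∧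
      (7 ≤ n → 4 ≤ t → t ≤ n - 3 →
        (indepCount G t = indepCount (completeBip 3 (n - 3)) t ↔
          ∃ F : SimpleGraph (Fin 3), Nonempty (G ≃g completeBipPlus F (n - 3))))) ∧
    (3 ≤ δ → 2 * δ + 1 ≤ t →
      indepCount G t ≤ indepCount (completeBip δ (n - δ)) t ∧
      (3 * δ + 1 ≤ n → t ≤ n - δ →
        (indepCount G t = indepCount (completeBip δ (n - δ)) t ↔
          ∃ F : SimpleGraph (Fin δ), Nonempty (G ≃g completeBipPlus F (n - δ))))) := by
  obtain ⟨h₂, h₃, h⟩ := mainTheorem1_general G n δ t hn hδ.ge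
  exact ⟨fun e ht => (h₂ e ht).imp_right fun h _ => h,
    fun e ht => (h₃ e ht).imp_right (And.imp_right fun h _ => h),
    fun hδ ht => (h (by omega) ht).imp_right fun h _ => h⟩
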